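/- Let $\mathring\Phi$ be a finite, crystallographic, reduced, irreducible root system in a Euclidean space $V$ that is not simply laced. Let $\mathring\Phi_s$, $\mathring\Phi_\ell$ be its sets of short and long roots, and let $m\in\{2,3\}$ be its lacing number, i.e. the ratio of the squared lengths of long and short roots. Equip $V\oplus\mathbb R$ with the form $(v_1\oplus y_1,v_2\oplus y_2)=(v_1,v_2)$, and let $$\Phi=\{\alpha\oplus y:\alpha\in\mathring\Phi,\ y\in\Lambda_\alpha\},\qquad \Lambda_\alpha=\mathbb Z\ (\alpha\in\mathring\Phi_s),\qquad \Lambda_\alpha=m\mathbb Z\ (\alpha\in\mathring\Phi_\ell),$$ be the set of real roots of the corresponding twisted affine root system. For $a$ with $(a,a)\ne0$ put $s_a(x)=x-\frac{2(x,a)}{(a,a)}a$. A root subsystem of $\Phi$ (or of $\mathring\Phi$) is a non-empty subset $\Psi$ with $s_a(b)\in\Psi$ for all $a,b\in\Psi$; it is maximal if it is proper and is not strictly contained in another proper root subsystem. For a root subsystem $\Psi$ of $\Phi$ let $Y_\alpha(\Psi)=\{y\in\Lambda_\alpha:\alpha\oplus y\in\Psi\}$ and $\mathrm{Gr}(\Psi)=\{\alpha\in\mathring\Phi: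 Y_\alpha(\Psi)\neq\emptyset\}$, and for $S\subseteq\mathring\Phi$ let $\widehat S=\{\alpha\oplus y:\alpha\in S,\ y\in\Lambda_\alpha\}$. **Proposition.** A root subsystem $\Psi$ of $\Phi$ is a maximal root subsystem of $\Phi$ if and only if one of the following holds: 1. $\mathrm{Gr}(\Psi)$ is a maximal root subsystem of $\mathring\Phi$, $\mathrm{Gr}(\Psi)\ne\mathring\Phi_\ell$, and $\Psi=\widehat{\mathrm{Gr}(\Psi)}$. 2. $\mathrm{Gr}(\Psi)=\mathring\Phi$, and there is a $\mathbb Z$-linear function $p:\mathring\Phi\to\mathbb Z$, $\alpha\mapsto p_\alpha$ (the restriction of a homomorphism from the root lattice to $\mathbb Z$), with $p_\alpha\in Y_\alpha(\Psi)$ for all $\alpha\in\mathring\Phi$, such that one of the following holds: - (a) $\Psi=\{\alpha\oplus y:\alpha\in\mathring\Phi,\ y\in p_\alpha+m\mathbb Z\}$; - (b) there is a prime $q$ with $\gcd(m,q)=1$ such that $\Psi=\{\alpha\oplus y:\alpha\in\mathring\Phi_s,\ y\in p_\alpha+q\mathbb Z\}\cup\{\alpha\oplus y:\alpha\in\mathring\Phi_\ell,\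 y\in p_\alpha+mq\mathbb Z\}$. -/

import Mathlib

open Set

noncomputable section

namespace AffineReflection

/-! ### Reflections and root subsystems with respect to a bilinear form -/

section Form

variable {X : Type*} [AddCommGroup X] [Module ℝ X]

/-- The reflection `s_a(x) = x - (2 (x, a) / (a, a)) a`; it is used only for `(a, a) ≠ 0`. -/
def formReflection (B : LinearMap.BilinForm ℝ X) (a x : X) : X :=
  x - (2 * B x a / B a a) • a

/-- A root subsystem of a set `Φ` of real roots: a non-empty subset of `Φ` that is stable under
the reflections in its own elements. -/
structure IsRootSubsystem (B : LinearMap.BilinForm ℝ X) (Φ Ψ : Set X) : Prop where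
  nonempty : Ψ.Nonempty
  subset : Ψ ⊆ Φ
  refl_mem : ∀ a ∈ Ψ, ∀ b ∈ Ψ, formReflection B a b ∈ Ψ

/-- A maximal root subsystem of `Φ`: a proper root subsystem such that no other proper
root subsystem contains it. -/
structure IsMaximalRootSubsystem (B : LinearMap.BilinForm ℝ X) (Φ Ψ : Set X) : Prop where
  isRootSubsystem : IsRootSubsystem B Φ Ψ
  ne_top : Ψ ≠ Φ
  eq_of_subset : ∀ Ψ' : Set X, IsRootSubsystem B Φ Ψ' → Ψ ⊆ Ψ' → Ψ' ≠ Φ → Ψ = Ψ'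

end Form

/-! ### Short and long roots of a finite root system -/

section Finite

variable {ι V N : Type*} [Fintype ι] [AddCommGroup V] [Module ℝ V] [AddCommGroup N] [Module ℝ N]

/-- Squared length of a root, with respect to the canonical Weyl group invariant inner product
(unique up to a positive factor when the root system is irreducible). -/
def sqLength (P : RootPairing ι ℝ V N) (i : ι) : ℝ :=
  P.RootForm (P.root i) (P.root i)

/-- A root of minimal length. -/
def IsShort (P : RootPairing ι ℝ V N) (i : ι) : Prop :=
  ∀ j, sqLength P i ≤ sqLength P j

/-- A root of maximal length. -/
def IsLong (P : RootPairing ι ℝ V N) (i : ι) : Prop :=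
  ∀ j, sqLength P j ≤ sqLength P i

/-- The set of long roots. -/
def longRoots (P : RootPairing ι ℝ V N) : Set V :=
  {v | ∃ i, IsLong P i ∧ v = P.root i}

/-- `m` is the lacing number: the ratio of the squared lengths of the long and the short roots
(`1` in the simply laced types, `2` in types `B`, `C`, `F₄`, and `3` in type `G₂`). -/
def IsLacingNumber (P : RootPairing ι ℝ V N) (m : ℕ) : Prop :=
  ∀ i j, IsLong P i → IsShort P j → sqLength P i = m * sqLength P j

end Finite

/-! ### Extension data and affine reflection systems -/

/-- An extension datum `(Λ_α : α ∈ Φ̊ ∪ {0})` of type `(Φ̊, Y)`, where `Φ̊` is the set of roots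
of `P`. -/
structure ExtensionDatum {ι V N : Type*} [AddCommGroup V] [Module ℝ V] [AddCommGroup N]
    [Module ℝ N] (P : RootPairing ι ℝ V N) (Y : Type*) [AddCommGroup Y] [Module ℝ Y] where
  /-- the set attached to the root with index `i` -/
  Λ : ι → Set Y
  /-- the set attached to `0` -/
  Λ₀ : Set Y
  sub_mem : ∀ i j, ∀ y ∈ Λ j, ∀ z ∈ Λ i,
    y - P.pairing j i • z ∈ Λ (P.reflectionPerm i j)
  zero_mem_zero : (0 : Y) ∈ Λ₀
  zero_mem : ∀ i, (∀ j, P.root i ≠ (2 : ℝ) • P.root j) → (0 : Y) ∈ Λ i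
  nonempty : ∀ i, (Λ i).Nonempty
  span_eq_top : Submodule.span ℝ (Λ₀ ∪ ⋃ i, Λ i) = ⊤

/-- The form `(v₁ ⊕ y₁, v₂ ⊕ y₂) = (v₁, v₂)` on `X = V ⊕ Y`. -/
def affineForm {ι V N : Type*} [Fintype ι] [AddCommGroup V] [Module ℝ V] [AddCommGroup N]
    [Module ℝ N] (P : RootPairing ι ℝ V N) (Y : Type*) [AddCommGroup Y] [Module ℝ Y] :
    LinearMap.BilinForm ℝ (V × Y) :=
  P.RootForm.compl₁₂ (LinearMap.fst ℝ V Y) (LinearMap.fst ℝ V Y)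

namespace ExtensionDatum

variable {ι V N Y : Type*} [AddCommGroup V] [Module ℝ V] [AddCommGroup N]
  [Module ℝ N] [AddCommGroup Y] [Module ℝ Y] {P : RootPairing ι ℝ V N}

/-- The affine reflection system `Δ = (0 ⊕ Λ₀) ∪ ⋃_α (α ⊕ Λ_α)` in `V ⊕ Y`. -/
def roots (E : ExtensionDatum P Y) : Set (V × Y) :=
  {x | x.1 = 0 ∧ x.2 ∈ E.Λ₀} ∪ {x | ∃ i, x.1 = P.root i ∧ x.2 ∈ E.Λ i}

/-- The real roots `Φ = {x ∈ Δ : (x, x) ≠ 0}`. -/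
def realRoots [Fintype ι] (E : ExtensionDatum P Y) : Set (V × Y) :=
  {x | x ∈ E.roots ∧ affineForm P Y x x ≠ 0}

/-- The gradient `Gr(Ψ)`: the roots `α` of the finite root system with `α ⊕ y ∈ Ψ` for
some `y ∈ Λ_α`. -/
def gradient (E : ExtensionDatum P Y) (Ψ : Set (V × Y)) : Set V :=
  {v | ∃ i, v = P.root i ∧ ∃ y ∈ E.Λ i, (P.root i, y) ∈ Ψ}

/-- `Y_α(Ψ) = {y ∈ Λ_α : α ⊕ y ∈ Ψ}`, where `α` is the root with index `i`. -/
def fibre (E : ExtensionDatum P Y) (Ψ : Set (V × Y)) (i : ι) : Set Y :=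
  {y | y ∈ E.Λ i ∧ (P.root i, y) ∈ Ψ}

/-- The lift `{α ⊕ Λ_α : α ∈ S}` of a set `S` of roots of the finite root system. -/
def lift (E : ExtensionDatum P Y) (S : Set V) : Set (V × Y) :=
  {x | ∃ i, P.root i ∈ S ∧ x.1 = P.root i ∧ x.2 ∈ E.Λ i}

/-- The affine reflection system of `E` is a twisted affine root system, where `m` is the lacing
number of the finite root system: the latter is not simply laced, `Λ_s = ℤ` and `Λ_ℓ = mℤ`. -/
structure IsTwistedAffine [Fintype ι] (E : ExtensionDatum P ℝ) (m : ℕ) : Prop where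
  lacing : IsLacingNumber P m
  ne_one : m ≠ 1
  short_eq : ∀ i, IsShort P i → E.Λ i = {y : ℝ | ∃ k : ℤ, y = k}
  long_eq : ∀ i, IsLong P i → E.Λ i = {y : ℝ | ∃ k : ℤ, y = m * k}

end ExtensionDatum

/-- The value `p_α ∈ ℤ` at the root `α` with index `i` of a `ℤ`-linear function `p` on `Φ̊`, that
is, of a `ℤ`-linear map on the root lattice. -/
def valueAt {ι V N : Type*} [AddCommGroup V] [Module ℝ V] [AddCommGroup N] [Module ℝ N]
    {P : RootPairing ι ℝ V N} (p : P.rootSpan ℤ →ₗ[ℤ] ℤ) (i : ι) : ℤ :=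
  p (P.rootSpanMem ℤ i)

end AffineReflection

end

namespace AffineReflection

/-! ### Sets of integers closed under `(a, b) ↦ b - 2a` -/

/-! If the gradient of `Ψ` is proper, `Ψ` lies in the lift of its gradient, so maximality passes
between `Ψ` and the gradient. The long roots are the one exception: their lift lies in the proper
subsystem whose fibres are all `mℤ`. Any other maximal gradient contains a short root, over which
the lift has fibre `ℤ`; this forces every larger subsystem of full gradient to be `Φ`.

If the gradient is full, choosing one element of the fibre over each simple root determines a linear
`p` with values in all the fibres (`exists_valueAt_mem`). After translation by `p` the fibres
contain 0, hence are subgroups of `ℤ` depending only on root length: `sℤ` on short roots and `lℤ` on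
long ones, with `s ∣ l ∣ m * s` and `m ∣ l` (`exists_dvd`, `exists_eq_cosetRoots`). For fixed `p`,
inclusion is reversed divisibility of the pairs `(s, l)`, and `Φ` is the pair `(1, m)`. As `m` is
prime, the maximal proper pairs are `(m, m)` and `(q, m * q)` with `q ≠ m` prime. -/

theorem exists_mem_iff_natCast_dvd {Z : Set ℤ} (h0 : 0 ∈ Z)
    (hZ : ∀ a ∈ Z, ∀ b ∈ Z, b - 2 * a ∈ Z) : ∃ n : ℕ, ∀ k, k ∈ Z ↔ (n : ℤ) ∣ k := by
  have hneg : ∀ a ∈ Z, -a ∈ Z := fun a ha ↦ by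
    have := hZ a ha a ha
    rwa [show a - 2 * a = -a by ring] at this
  -- `Z` is stable under translation by twice the subgroup it generates, so it remains to find one
  -- odd multiple of the generator in `Z`.
  have key : ∀ g ∈ AddSubgroup.closure Z, ∀ b ∈ Z, b - 2 * g ∈ Z := by
    intro g hg
    induction hg using AddSubgroup.closure_induction'' with
    | zero => simp
    | mem a ha => exact hZ a ha
    | neg_mem a ha => exact hZ _ (hneg a ha)
    | add x y _ _ hx hy =>
      intro b hb
      have := hx _ (hy b hb)
      rwa [show b - 2 * y - 2 * x = b - 2 * (x + y) by ring] at this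
  obtain ⟨g, hg⟩ := Int.subgroup_cyclic (AddSubgroup.closure Z)
  have hmem : ∀ k, k ∈ AddSubgroup.closure Z ↔ g ∣ k := fun k ↦ by
    rw [hg, AddSubgroup.mem_closure_singleton]
    exact ⟨fun ⟨n, hn⟩ ↦ ⟨n, by rw [← hn, smul_eq_mul, mul_comm]⟩,
      fun ⟨n, hn⟩ ↦ ⟨n, by rw [hn, smul_eq_mul, mul_comm]⟩⟩
  have hgZ : g ∈ Z := by
    by_cases h : ∃ z ∈ Z, ∃ c, z = g * (2 * c + 1)
    · obtain ⟨z, hz, c, rfl⟩ := h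
      have := key (g * c) ((hmem _).2 ⟨c, rfl⟩) _ hz
      rwa [show g * (2 * c + 1) - 2 * (g * c) = g by ring] at this
    -- With even multiples only, `Z` would generate a subgroup of `2gℤ`, which forces `g = 0`.
    · have hle : AddSubgroup.closure Z ≤ AddSubgroup.zmultiples (2 * g) := by
        rw [AddSubgroup.closure_le]
        intro z hz
        obtain ⟨c, hc⟩ := (hmem z).1 (AddSubgroup.subset_closure hz)
        obtain ⟨d, hd | hd⟩ := Int.even_or_odd' c
        · exact Int.mem_zmultiples_iff.2 ⟨d, by rw [hc, hd]; ring⟩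
        · exact (h ⟨z, hz, d, by rw [hc, hd]⟩).elim
      obtain ⟨c, hc⟩ := Int.mem_zmultiples_iff.1 (hle ((hmem g).2 dvd_rfl))
      have : g * (1 - 2 * c) = 0 := by linear_combination hc
      rcases mul_eq_zero.1 this with h | h
      · rwa [h]
      · omega
  refine ⟨g.natAbs, fun k ↦ ?_⟩
  rw [Int.natAbs_dvd]
  refine ⟨fun hk ↦ (hmem k).1 (AddSubgroup.subset_closure hk), ?_⟩
  rintro ⟨c, rfl⟩
  obtain ⟨d, hd | hd⟩ := Int.even_or_odd' c
  · have := key (g * -d) ((hmem _).2 ⟨_, rfl⟩) 0 h0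
    rwa [show 0 - 2 * (g * -d) = g * c by rw [hd]; ring] at this
  · have := key (g * -d) ((hmem _).2 ⟨_, rfl⟩) g hgZ
    rwa [show g - 2 * (g * -d) = g * c by rw [hd]; ring] at this

/-! ### Lengths of roots -/

section Finite

variable {ι V N : Type*} [Fintype ι] [AddCommGroup V] [Module ℝ V] [AddCommGroup N] [Module ℝ N]
  {P : RootPairing ι ℝ V N}

theorem IsShort.sqLength_eq {i j : ι} (hi : IsShort P i) (hj : IsShort P j) :
    sqLength P i = sqLength P j := le_antisymm (hi j) (hj i)

theorem IsLong.sqLength_eq {i j : ι} (hi : IsLong P i) (hj : IsLong P j) :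
    sqLength P i = sqLength P j := le_antisymm (hj i) (hi j)

variable (P) in
@[simp]
theorem sqLength_reflectionPerm (i j : ι) :
    sqLength P (P.reflectionPerm i j) = sqLength P j := by
  simp [sqLength]

@[simp]
theorem isShort_reflectionPerm {i j : ι} : IsShort P (P.reflectionPerm i j) ↔ IsShort P j := by
  simp [IsShort]

@[simp]
theorem isLong_reflectionPerm {i j : ι} : IsLong P (P.reflectionPerm i j) ↔ IsLong P j := by
  simp [IsLong]

variable (P) in
theorem exists_isShort [Nonempty ι] : ∃ i, IsShort P i := Finite.exists_min (sqLength P)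

variable (P) in
theorem exists_isLong [Nonempty ι] : ∃ i, IsLong P i := Finite.exists_max (sqLength P)

omit [Fintype ι] in
theorem nonempty_of_isIrreducible [P.IsRootSystem] [P.IsIrreducible] : Nonempty ι := by
  by_contra h
  rw [not_nonempty_iff] at h
  have := RootPairing.IsIrreducible.nontrivial P
  have h1 := RootPairing.IsRootSystem.span_root_eq_top (P := P)
  rw [range_eq_empty, Submodule.span_empty] at h1
  exact bot_ne_top h1

omit [Fintype ι] in
/-- In an irreducible root system, no root is orthogonal to all roots of a non-empty set of roots
that is stable under all reflections. -/
theorem exists_mem_pairingIn_ne_zero [P.IsCrystallographic] [P.IsIrreducible] {S : Set ι}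
    (hne : S.Nonempty) (hS : ∀ i, ∀ j ∈ S, P.reflectionPerm i j ∈ S) (i : ι) :
    ∃ k ∈ S, P.pairingIn ℤ i k ≠ 0 := by
  by_contra! h
  -- The span of a reflection-stable set is an invariant subspace, hence everything. The coroot of
  -- `i` would vanish on it, yet it takes the value 2 on the root `i`.
  have htop : Submodule.span ℝ (P.root '' S) = ⊤ := by
    refine RootPairing.IsIrreducible.eq_top_of_invtSubmodule_reflection (P := P) _ (fun j ↦ ?_) ?_
    · rw [Module.End.mem_invtSubmodule, Submodule.span_le]
      rintro _ ⟨k, hk, rfl⟩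
      exact Submodule.subset_span ⟨_, hS j k hk, by simp⟩
    · obtain ⟨j, hj⟩ := hne
      exact fun hbot ↦ P.ne_zero j <| (Submodule.mem_bot ℝ).1 <|
        hbot ▸ Submodule.subset_span (mem_image_of_mem _ hj)
  have hle : Submodule.span ℝ (P.root '' S) ≤ LinearMap.ker (P.coroot' i) := by
    rw [Submodule.span_le]
    rintro _ ⟨k, hk, rfl⟩
    have := P.pairingIn_eq_zero_iff.1 (h k hk)
    simp [← P.algebraMap_pairingIn ℤ, this]
  have : P.root i ∈ LinearMap.ker (P.coroot' i) := hle (htop ▸ Submodule.mem_top)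
  simp at this

variable [P.IsCrystallographic]

omit [P.IsCrystallographic] in
variable (P) in
theorem sqLength_pos (i : ι) : 0 < sqLength P i := by
  obtain ⟨s, hs, h⟩ := (P.posRootForm ℝ).exists_pos_eq i
  rw [sqLength]
  exact hs.trans_eq h

theorem pairingIn_mul_sqLength (i j : ι) :
    P.pairingIn ℤ j i * sqLength P i = P.pairingIn ℤ i j * sqLength P j := by
  have := P.toInvariantForm.pairing_mul_eq_pairing_mul_swap i j
  simpa [← P.algebraMap_pairingIn ℤ, sqLength] using this

omit [P.IsCrystallographic] in
theorem two_mul_rootForm_div_sqLength (i j : ι) :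
    2 * P.RootForm (P.root j) (P.root i) / P.RootForm (P.root i) (P.root i) = P.pairing j i := by
  have h := P.toInvariantForm.two_mul_apply_root_root j i
  simp only [RootPairing.toInvariantForm_form] at h
  rw [h, mul_div_cancel_right₀]
  exact (sqLength_pos P i).ne'

theorem pairingIn_eq_of_sqLength_eq {i j : ι} (h : sqLength P i = sqLength P j) :
    P.pairingIn ℤ i j = P.pairingIn ℤ j i := by
  have := pairingIn_mul_sqLength (P := P) i j
  rw [h] at this
  exact_mod_cast (mul_right_cancel₀ (sqLength_pos P j).ne' this).symm

/-! ### The two root lengths and the pairings between them -/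

namespace IsLacingNumber

variable [P.IsRootSystem] [P.IsReduced] [P.IsIrreducible] {m : ℕ} (hm : IsLacingNumber P m)
  (hm1 : m ≠ 1)
include hm hm1

theorem eq_two_or_three : m = 2 ∨ m = 3 := by
  have := nonempty_of_isIrreducible (P := P)
  obtain ⟨i, hi⟩ := exists_isLong P
  obtain ⟨j, hj⟩ := exists_isShort P
  have h := P.toInvariantForm.apply_eq_or i j
  simp only [RootPairing.toInvariantForm_form] at h
  change sqLength P i = sqLength P j ∨ sqLength P i = 2 * sqLength P j ∨
    sqLength P i = 3 * sqLength P j ∨ sqLength P j = 2 * sqLength P i ∨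
    sqLength P j = 3 * sqLength P i at h
  have hp := sqLength_pos P j
  have hp' := sqLength_pos P i
  have hji := hj i
  have hmij := hm i j hi hj
  have aux : ∀ c : ℕ, sqLength P i = c * sqLength P j → m = c := fun c hc ↦ by
    exact_mod_cast mul_right_cancel₀ hp.ne' (hmij.symm.trans hc)
  rcases h with h | h | h | h | h
  · exact (hm1 (aux 1 (by simpa using h))).elim
  · exact .inl (aux 2 (by simpa using h))
  · exact .inr (aux 3 (by simpa using h))
  · linarith
  · linarith

theorem prime : m.Prime := by
  rcases hm.eq_two_or_three hm1 with rfl | rfl <;> norm_num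

omit [P.IsRootSystem] [P.IsReduced] [P.IsIrreducible] [P.IsCrystallographic] in
theorem not_isLong_of_isShort {i : ι} (hi : IsShort P i) : ¬ IsLong P i := fun hl ↦ by
  have h := hm i i hl hi
  have hp := sqLength_pos P i
  have : (1 : ℝ) = m := mul_right_cancel₀ hp.ne' (by rw [one_mul]; exact h)
  exact hm1 (by exact_mod_cast this.symm)

theorem isShort_or_isLong (i : ι) : IsShort P i ∨ IsLong P i := by
  have := nonempty_of_isIrreducible (P := P)
  obtain ⟨l, hl⟩ := exists_isLong P
  obtain ⟨s, hs⟩ := exists_isShort P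
  have hne : sqLength P s ≠ sqLength P l := fun h ↦
    hm.not_isLong_of_isShort hm1 hs fun j ↦ h ▸ hl j
  have h := P.toInvariantForm.apply_eq_or_of_apply_ne hne i
  change sqLength P i = sqLength P s ∨ sqLength P i = sqLength P l at h
  rcases h with h | h
  · exact .inl fun j ↦ h ▸ hs j
  · exact .inr fun j ↦ h ▸ hl j

omit [P.IsRootSystem] [P.IsReduced] [P.IsIrreducible] hm1 in
theorem pairingIn_eq_mul {i j : ι} (hi : IsShort P i) (hj : IsLong P j) :
    P.pairingIn ℤ j i = m * P.pairingIn ℤ i j := by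
  have h := pairingIn_mul_sqLength (P := P) i j
  rw [hm j i hj hi, ← mul_assoc] at h
  have := mul_right_cancel₀ (sqLength_pos P i).ne' h
  have h2 : (P.pairingIn ℤ j i : ℝ) = ((m * P.pairingIn ℤ i j : ℤ) : ℝ) := by
    rw [this]; push_cast; ring
  exact_mod_cast h2

/-- The two pairings are `n` and `m * n`, and for roots of different lengths their product `m * n ^
2` is at most 3. -/
theorem pairingIn_eq_one_or_neg_one {i j : ι} (hi : IsShort P i) (hj : IsLong P j)
    (h : P.pairingIn ℤ j i ≠ 0) : P.pairingIn ℤ i j = 1 ∨ P.pairingIn ℤ i j = -1 := by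
  have h1 := hm.pairingIn_eq_mul hi hj
  have h2 := P.pairingIn_pairingIn_mem_set_of_isCrystal_of_isRed i j
  simp only [mem_insert_iff, mem_singleton_iff, Prod.mk.injEq] at h2
  rcases hm.eq_two_or_three hm1 with rfl | rfl <;> push_cast at h1 <;> omega

end IsLacingNumber

/-! ### Families of sets of integers closed under reflections -/

/-- A family of sets of integers, indexed by the roots, is closed under the reflections of the
affine roots `α ⊕ y` with `y` in the set attached to `α`. -/
def IsReflectionClosed (P : RootPairing ι ℝ V N) [P.IsCrystallographic] (F : ι → Set ℤ) : Prop :=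
  ∀ i j, ∀ a ∈ F i, ∀ b ∈ F j, b - P.pairingIn ℤ j i * a ∈ F (P.reflectionPerm i j)

omit [Fintype ι] in
theorem valueAt_reflectionPerm (p : P.rootSpan ℤ →ₗ[ℤ] ℤ) (i j : ι) :
    valueAt p (P.reflectionPerm i j) = valueAt p j - P.pairingIn ℤ j i * valueAt p i := by
  have : P.rootSpanMem ℤ (P.reflectionPerm i j) =
      P.rootSpanMem ℤ j - P.pairingIn ℤ j i • P.rootSpanMem ℤ i := by
    ext
    simp [RootPairing.reflection_apply_root' ℤ]
  rw [valueAt, this, map_sub, map_smul, smul_eq_mul, valueAt, valueAt]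

namespace IsReflectionClosed

variable {F : ι → Set ℤ} (hF : IsReflectionClosed P F)
include hF

/-- Simple roots form a basis of the root lattice, so `p` may be prescribed there. A linear `p`
transforms under reflections exactly as the fibres do, and every root is reached from simple roots
by simple reflections and negation. -/
theorem exists_valueAt_mem [P.IsReduced] [P.IsRootSystem] (hne : ∀ i, (F i).Nonempty) :
    ∃ p : P.rootSpan ℤ →ₗ[ℤ] ℤ, ∀ i, valueAt p i ∈ F i := by
  obtain ⟨b⟩ := P.nonempty_base
  choose f hf using hne
  let p := b.toWeightBasisInt.constr ℤ fun i : b.support ↦ f i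
  have hbase : ∀ j ∈ b.support, valueAt p j ∈ F j := fun j hj ↦ by
    have h1 : P.rootSpanMem ℤ j = b.toWeightBasisInt ⟨j, hj⟩ := by ext; simp
    rw [valueAt, h1, show p (b.toWeightBasisInt ⟨j, hj⟩) = f j from
      b.toWeightBasisInt.constr_basis ℤ _ _]
    exact hf j
  refine ⟨p, fun i ↦ ?_⟩
  refine b.induction_reflect i (p := fun i ↦ valueAt p i ∈ F i) ?_ ?_ ?_
  · intro j hj
    have := hF j j _ hj _ hj
    rwa [← valueAt_reflectionPerm] at this
  · exact hbase
  · intro j k hj hk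
    have := hF k j _ (hbase k hk) _ hj
    rwa [← valueAt_reflectionPerm] at this

omit [Fintype ι] in
-- This translation reduces to families with 0 in every set.
theorem preimage_valueAt_add (p : P.rootSpan ℤ →ₗ[ℤ] ℤ) :
    IsReflectionClosed P fun i ↦ {k | valueAt p i + k ∈ F i} := by
  intro i j a ha b hb
  have := hF i j _ ha _ hb
  rw [mem_ofPred_eq, valueAt_reflectionPerm]
  convert this using 1
  ring

/-! ### Closed families containing 0: subgroups depending only on root length -/

section Zero

variable (h0 : ∀ i, 0 ∈ F i)
include h0

omit [Fintype ι] in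
theorem reflectionPerm_eq (i j : ι) : F (P.reflectionPerm i j) = F j := by
  have h : ∀ j, F j ⊆ F (P.reflectionPerm i j) := fun j b hb ↦ by
    simpa using hF i j 0 (h0 i) b hb
  refine (h j).antisymm' ?_
  simpa using h (P.reflectionPerm i j)

omit [Fintype ι] in
theorem sub_mem {i j : ι} {a b : ℤ} (ha : a ∈ F i) (hb : b ∈ F j) :
    b - P.pairingIn ℤ j i * a ∈ F j :=
  hF.reflectionPerm_eq h0 i j ▸ hF i j a ha b hb

omit [Fintype ι] in
theorem exists_mem_iff_dvd : ∃ n : ι → ℕ, ∀ i k, k ∈ F i ↔ (n i : ℤ) ∣ k := by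
  have (i : ι) : ∃ n : ℕ, ∀ k, k ∈ F i ↔ (n : ℤ) ∣ k := by
    refine exists_mem_iff_natCast_dvd (h0 i) fun a ha b hb ↦ ?_
    simpa using hF.sub_mem h0 ha hb
  choose n hn using this
  exact ⟨n, hn⟩

omit [Fintype ι] in
theorem mem_of_pairingIn_eq_one_or_neg_one {i j : ι}
    (h : P.pairingIn ℤ j i = 1 ∨ P.pairingIn ℤ j i = -1) : F i ⊆ F j := fun a ha ↦ by
  have ha' : -a ∈ F i := by
    have := hF.sub_mem h0 ha ha
    rw [P.pairingIn_same] at this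
    rwa [show a - 2 * a = -a by ring] at this
  rcases h with h | h
  · simpa [h] using hF.sub_mem h0 ha' (h0 j)
  · simpa [h] using hF.sub_mem h0 ha (h0 j)

variable [P.IsReduced] [P.IsIrreducible]

/-- By irreducibility, some root `k` with the length and the set of `j` is not orthogonal to `i`.
Equal lengths make the pairings symmetric: either both are 1 or both are -1, giving inclusions both
ways, or `k` is `i` or its negative. -/
theorem eq_of_sqLength_eq {i j : ι} (h : sqLength P i = sqLength P j) : F i = F j := by
  obtain ⟨k, ⟨hk1, hk2⟩, hk3⟩ := exists_mem_pairingIn_ne_zero (P := P)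
    (S := {k | F k = F j ∧ sqLength P k = sqLength P j}) ⟨j, rfl, rfl⟩
    (fun l k hk ↦ by simpa [hF.reflectionPerm_eq h0] using hk) i
  have h1 := pairingIn_eq_of_sqLength_eq (h.trans hk2.symm)
  have h2 := P.pairingIn_pairingIn_mem_set_of_isCrystal_of_isRed i k
  simp only [mem_insert_iff, mem_singleton_iff, Prod.mk.injEq] at h2
  have h3 : P.pairingIn ℤ i k = 1 ∨ P.pairingIn ℤ i k = -1 ∨
      (P.pairingIn ℤ i k = 2 ∧ P.pairingIn ℤ k i = 2) ∨
      (P.pairingIn ℤ i k = -2 ∧ P.pairingIn ℤ k i = -2) := by omega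
  rw [← hk1]
  rcases h3 with h3 | h3 | h3 | h3
  · exact (hF.mem_of_pairingIn_eq_one_or_neg_one h0 (.inl (h1 ▸ h3))).antisymm
      (hF.mem_of_pairingIn_eq_one_or_neg_one h0 (.inl h3))
  · exact (hF.mem_of_pairingIn_eq_one_or_neg_one h0 (.inr (h1 ▸ h3))).antisymm
      (hF.mem_of_pairingIn_eq_one_or_neg_one h0 (.inr h3))
  · rw [(P.pairingIn_two_two_iff ℤ i k).1 h3]
  · have h4 := (P.pairingIn_neg_two_neg_two_iff ℤ i k).1 h3
    have : i = P.reflectionPerm k k := P.root.injective (by simpa using h4)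
    rw [this, hF.reflectionPerm_eq h0]

/-- The structure of a reflection closed family that contains `0` everywhere. -/
theorem exists_dvd [P.IsRootSystem] {m : ℕ} (hm : IsLacingNumber P m) (hm1 : m ≠ 1) :
    ∃ s l : ℕ, s ∣ l ∧ l ∣ m * s ∧ (∀ i, IsShort P i → ∀ k, k ∈ F i ↔ (s : ℤ) ∣ k) ∧
      (∀ i, IsLong P i → ∀ k, k ∈ F i ↔ (l : ℤ) ∣ k) := by
  have := nonempty_of_isIrreducible (P := P)
  obtain ⟨n, hn⟩ := hF.exists_mem_iff_dvd h0
  obtain ⟨j, hj⟩ := exists_isLong P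
  obtain ⟨i₀, hi₀⟩ := exists_isShort P
  obtain ⟨i, hi, hij⟩ := exists_mem_pairingIn_ne_zero (P := P) (S := {i | IsShort P i}) ⟨i₀, hi₀⟩
    (fun l k hk ↦ by simpa using hk) j
  have hij' := hm.pairingIn_eq_one_or_neg_one hm1 hi hj hij
  refine ⟨n i, n j, ?_, ?_, fun i' hi' k ↦ ?_, fun j' hj' k ↦ ?_⟩
  -- The long root `j` pairs to `±1` with the coroot direction that carries its set into that of the
  -- short root `i`.
  · have := hF.mem_of_pairingIn_eq_one_or_neg_one h0 hij' ((hn j (n j)).2 dvd_rfl)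
    rw [hn] at this
    exact_mod_cast this
  -- In the other direction the pairing is `±m`, so reflecting 0 produces `±m * n i` over `j`.
  · have := hF.sub_mem h0 ((hn i (n i)).2 dvd_rfl) (h0 j)
    rw [hm.pairingIn_eq_mul hi hj, hn] at this
    have h2 : (n j : ℤ) ∣ m * n i := by
      rcases hij' with h | h <;> simpa [h] using this
    exact_mod_cast h2
  · rw [hF.eq_of_sqLength_eq h0 (hi'.sqLength_eq hi), hn]
  · rw [hF.eq_of_sqLength_eq h0 (hj'.sqLength_eq hj), hn]

end Zero

end IsReflectionClosed

end Finite

/-! ### Root subsystems of a twisted affine root system -/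

section Affine

variable {ι V N : Type*} [Fintype ι] [AddCommGroup V] [Module ℝ V] [AddCommGroup N] [Module ℝ N]
  {P : RootPairing ι ℝ V N} [P.IsCrystallographic]

omit [P.IsCrystallographic] in
theorem formReflection_rootForm (i j : ι) :
    formReflection P.RootForm (P.root i) (P.root j) = P.root (P.reflectionPerm i j) := by
  rw [formReflection, two_mul_rootForm_div_sqLength, P.root_reflectionPerm,
    P.reflection_apply_root]

omit [P.IsCrystallographic] in
theorem formReflection_affineForm {Y : Type*} [AddCommGroup Y] [Module ℝ Y] (i j : ι) (y z : Y) :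
    formReflection (affineForm P Y) (P.root i, y) (P.root j, z) =
      (P.root (P.reflectionPerm i j), z - P.pairing j i • y) := by
  have h : ∀ u v : V × Y, affineForm P Y u v = P.RootForm u.1 v.1 := fun _ _ ↦ rfl
  rw [formReflection, h, h, two_mul_rootForm_div_sqLength, P.root_reflectionPerm,
    P.reflection_apply_root]
  rfl

namespace ExtensionDatum

/-! ### Gradients and lifts for an arbitrary extension datum -/

section General

variable {Y : Type*} [AddCommGroup Y] [Module ℝ Y] {E : ExtensionDatum P Y}

omit [P.IsCrystallographic] in
theorem mem_realRoots {x : V × Y} : x ∈ E.realRoots ↔ ∃ i, x.1 = P.root i ∧ x.2 ∈ E.Λ i := by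
  have h : affineForm P Y x x = P.RootForm x.1 x.1 := rfl
  simp only [realRoots, roots, mem_ofPred_eq, mem_union, h]
  constructor
  · rintro ⟨⟨h1, -⟩ | h1, h2⟩
    · simp [h1] at h2
    · exact h1
  · rintro ⟨i, h1, h2⟩
    exact ⟨.inr ⟨i, h1, h2⟩, h1 ▸ (sqLength_pos P i).ne'⟩

omit [P.IsCrystallographic] in
theorem root_mk_mem_realRoots {i : ι} {y : Y} : (P.root i, y) ∈ E.realRoots ↔ y ∈ E.Λ i := by
  rw [mem_realRoots]
  refine ⟨?_, fun h ↦ ⟨i, rfl, h⟩⟩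
  rintro ⟨j, h1, h2⟩
  rwa [P.root.injective h1]

omit [P.IsCrystallographic] in
theorem mem_gradient {Ψ : Set (V × Y)} (hΨ : Ψ ⊆ E.realRoots) {i : ι} :
    P.root i ∈ E.gradient Ψ ↔ ∃ y, (P.root i, y) ∈ Ψ := by
  constructor
  · rintro ⟨j, hj, y, -, h⟩
    exact ⟨y, hj ▸ h⟩
  · rintro ⟨y, h⟩
    exact ⟨i, rfl, y, root_mk_mem_realRoots.1 (hΨ h), h⟩

omit [Fintype ι] [P.IsCrystallographic] in
theorem gradient_subset (Ψ : Set (V × Y)) : E.gradient Ψ ⊆ range P.root := by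
  rintro _ ⟨i, rfl, -⟩
  exact mem_range_self i

omit [Fintype ι] [P.IsCrystallographic] in
theorem gradient_mono {Ψ Ψ' : Set (V × Y)} (h : Ψ ⊆ Ψ') : E.gradient Ψ ⊆ E.gradient Ψ' := by
  rintro _ ⟨i, rfl, y, hy, hi⟩
  exact ⟨i, rfl, y, hy, h hi⟩

omit [Fintype ι] [P.IsCrystallographic] in
theorem root_mk_mem_lift {S : Set V} {i : ι} {y : Y} :
    (P.root i, y) ∈ E.lift S ↔ P.root i ∈ S ∧ y ∈ E.Λ i := by
  constructor
  · rintro ⟨j, h1, h2, h3⟩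
    obtain rfl := P.root.injective h2
    exact ⟨h1, h3⟩
  · rintro ⟨h1, h2⟩
    exact ⟨i, h1, rfl, h2⟩

omit [P.IsCrystallographic] in
theorem lift_subset (S : Set V) : E.lift S ⊆ E.realRoots := by
  rintro x ⟨i, -, h⟩
  exact mem_realRoots.2 ⟨i, h⟩

omit [P.IsCrystallographic] in
theorem subset_lift_gradient {Ψ : Set (V × Y)} (hΨ : Ψ ⊆ E.realRoots) :
    Ψ ⊆ E.lift (E.gradient Ψ) := by
  rintro ⟨v, y⟩ hx
  obtain ⟨i, rfl, hy⟩ := mem_realRoots.1 (hΨ hx)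
  exact root_mk_mem_lift.2 ⟨⟨i, rfl, y, hy, hx⟩, hy⟩

omit [Fintype ι] [P.IsCrystallographic] in
theorem lift_mono {S T : Set V} (h : S ⊆ T) : E.lift S ⊆ E.lift T := by
  rintro x ⟨i, hi, hx⟩
  exact ⟨i, h hi, hx⟩

omit [Fintype ι] [P.IsCrystallographic] in
theorem gradient_lift {S : Set V} (hS : S ⊆ range P.root) : E.gradient (E.lift S) = S := by
  ext v
  constructor
  · rintro ⟨i, rfl, y, -, hy⟩
    exact (root_mk_mem_lift.1 hy).1
  · intro hv
    obtain ⟨i, rfl⟩ := hS hv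
    obtain ⟨y, hy⟩ := E.nonempty i
    exact ⟨i, rfl, y, hy, root_mk_mem_lift.2 ⟨hv, hy⟩⟩

omit [P.IsCrystallographic] in
theorem gradient_realRoots : E.gradient E.realRoots = range P.root := by
  refine (gradient_subset _).antisymm ?_
  rintro _ ⟨i, rfl⟩
  obtain ⟨y, hy⟩ := E.nonempty i
  exact ⟨i, rfl, y, hy, root_mk_mem_realRoots.2 hy⟩

omit [P.IsCrystallographic] in
theorem isRootSubsystem_lift {S : Set V} (hS : IsRootSubsystem P.RootForm (range P.root) S) :
    IsRootSubsystem (affineForm P Y) E.realRoots (E.lift S) where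
  nonempty := by
    obtain ⟨v, hv⟩ := hS.nonempty
    obtain ⟨i, rfl⟩ := hS.subset hv
    obtain ⟨y, hy⟩ := E.nonempty i
    exact ⟨_, root_mk_mem_lift.2 ⟨hv, hy⟩⟩
  subset := lift_subset S
  refl_mem := by
    rintro ⟨_, y⟩ ⟨i, hi, rfl, hy⟩ ⟨_, z⟩ ⟨j, hj, rfl, hz⟩
    rw [formReflection_affineForm, root_mk_mem_lift, ← formReflection_rootForm]
    exact ⟨hS.refl_mem _ hi _ hj, E.sub_mem i j z hz y hy⟩

omit [P.IsCrystallographic] in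
theorem isRootSubsystem_gradient {Ψ : Set (V × Y)}
    (hΨ : IsRootSubsystem (affineForm P Y) E.realRoots Ψ) :
    IsRootSubsystem P.RootForm (range P.root) (E.gradient Ψ) where
  nonempty := by
    obtain ⟨⟨v, y⟩, hx⟩ := hΨ.nonempty
    obtain ⟨i, rfl, hy⟩ := mem_realRoots.1 (hΨ.subset hx)
    exact ⟨P.root i, (mem_gradient hΨ.subset).2 ⟨y, hx⟩⟩
  subset := gradient_subset Ψ
  refl_mem := by
    rintro _ ⟨i, rfl, y, -, hi⟩ _ ⟨j, rfl, z, -, hj⟩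
    rw [formReflection_rootForm, mem_gradient hΨ.subset]
    have := hΨ.refl_mem _ hi _ hj
    rw [formReflection_affineForm] at this
    exact ⟨_, this⟩

end General

end ExtensionDatum

open ExtensionDatum

omit [P.IsCrystallographic] in
theorem isRootSubsystem_longRoots [Nonempty ι] :
    IsRootSubsystem P.RootForm (range P.root) (longRoots P) where
  nonempty := by
    obtain ⟨i, hi⟩ := exists_isLong P
    exact ⟨_, i, hi, rfl⟩
  subset := by
    rintro _ ⟨i, -, rfl⟩
    exact mem_range_self i
  refl_mem := by
    rintro _ ⟨i, -, rfl⟩ _ ⟨j, hj, rfl⟩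
    rw [formReflection_rootForm]
    exact ⟨_, isLong_reflectionPerm.2 hj, rfl⟩

omit [P.IsCrystallographic] in
theorem root_mem_longRoots {i : ι} : P.root i ∈ longRoots P ↔ IsLong P i := by
  refine ⟨?_, fun h ↦ ⟨i, h, rfl⟩⟩
  rintro ⟨j, hj, h⟩
  rwa [P.root.injective h]

/-- The affine roots `α ⊕ y` with `y ∈ p_α + sℤ` for `α` short and `y ∈ p_α + lℤ` for `α` long. -/
def cosetRoots (p : P.rootSpan ℤ →ₗ[ℤ] ℤ) (s l : ℕ) : Set (V × ℝ) :=
  {x | ∃ i, ∃ k : ℤ, x = (P.root i, (k : ℝ)) ∧ (IsShort P i → (s : ℤ) ∣ k - valueAt p i) ∧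
    (IsLong P i → (l : ℤ) ∣ k - valueAt p i)}

omit [P.IsCrystallographic] in
theorem mem_cosetRoots {p : P.rootSpan ℤ →ₗ[ℤ] ℤ} {s l : ℕ} {i : ι} {k : ℤ} :
    (P.root i, (k : ℝ)) ∈ cosetRoots p s l ↔ (IsShort P i → (s : ℤ) ∣ k - valueAt p i) ∧
      (IsLong P i → (l : ℤ) ∣ k - valueAt p i) := by
  refine ⟨?_, fun h ↦ ⟨i, k, rfl, h⟩⟩
  rintro ⟨j, k', h, h'⟩
  simp only [Prod.mk.injEq, EmbeddingLike.apply_eq_iff_eq, Int.cast_inj] at h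
  rwa [h.1, h.2]

omit [P.IsCrystallographic] in
theorem root_valueAt_mem_cosetRoots (p : P.rootSpan ℤ →ₗ[ℤ] ℤ) (s l : ℕ) (i : ι) :
    (P.root i, (valueAt p i : ℝ)) ∈ cosetRoots p s l := by
  simp [mem_cosetRoots]

omit [P.IsCrystallographic] in
theorem cosetRoots_mono (p : P.rootSpan ℤ →ₗ[ℤ] ℤ) {s l s' l' : ℕ} (hs : s' ∣ s) (hl : l' ∣ l) :
    cosetRoots p s l ⊆ cosetRoots p s' l' := by
  rintro _ ⟨i, k, rfl, h1, h2⟩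
  exact mem_cosetRoots.2 ⟨fun h ↦ (Int.natCast_dvd_natCast.2 hs).trans (h1 h),
    fun h ↦ (Int.natCast_dvd_natCast.2 hl).trans (h2 h)⟩

/-- The integers `k` such that `α ⊕ k` belongs to `Ψ`. -/
def intFibre (P : RootPairing ι ℝ V N) (Ψ : Set (V × ℝ)) (i : ι) : Set ℤ :=
  {k | (P.root i, (k : ℝ)) ∈ Ψ}

theorem IsRootSubsystem.isReflectionClosed_intFibre {Φ Ψ : Set (V × ℝ)}
    (hΨ : IsRootSubsystem (affineForm P ℝ) Φ Ψ) : IsReflectionClosed P (intFibre P Ψ) := by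
  intro i j a ha b hb
  have := hΨ.refl_mem _ ha _ hb
  rw [formReflection_affineForm, ← P.algebraMap_pairingIn ℤ] at this
  simpa [intFibre] using this

variable [P.IsRootSystem] [P.IsReduced] [P.IsIrreducible] {m : ℕ}

theorem cosetRoots_eq_union (hm : IsLacingNumber P m) (hm1 : m ≠ 1)
    (p : P.rootSpan ℤ →ₗ[ℤ] ℤ) (s l : ℕ) :
    cosetRoots p s l = {x | ∃ i, IsShort P i ∧ ∃ k : ℤ, x = (P.root i, (valueAt p i + s * k : ℝ))} ∪
      {x | ∃ i, IsLong P i ∧ ∃ k : ℤ, x = (P.root i, (valueAt p i + l * k : ℝ))} := by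
  ext x
  constructor
  · rintro ⟨i, k, rfl, h1, h2⟩
    rcases hm.isShort_or_isLong hm1 i with hi | hi
    · obtain ⟨c, hc⟩ := h1 hi
      refine .inl ⟨i, hi, c, ?_⟩
      rw [eq_add_of_sub_eq' hc]
      push_cast
      rfl
    · obtain ⟨c, hc⟩ := h2 hi
      refine .inr ⟨i, hi, c, ?_⟩
      rw [eq_add_of_sub_eq' hc]
      push_cast
      rfl
  · rintro (⟨i, hi, k, rfl⟩ | ⟨i, hi, k, rfl⟩)
    · refine ⟨i, valueAt p i + s * k, by push_cast; rfl, fun _ ↦ by simp, fun h ↦ ?_⟩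
      exact (hm.not_isLong_of_isShort hm1 hi h).elim
    · refine ⟨i, valueAt p i + l * k, by push_cast; rfl, fun h ↦ ?_, fun _ ↦ by simp⟩
      exact (hm.not_isLong_of_isShort hm1 h hi).elim

theorem cosetRoots_self (hm : IsLacingNumber P m) (hm1 : m ≠ 1)
    (p : P.rootSpan ℤ →ₗ[ℤ] ℤ) (s : ℕ) :
    cosetRoots p s s = {x | ∃ i, ∃ k : ℤ, x = (P.root i, (valueAt p i + s * k : ℝ))} := by
  rw [cosetRoots_eq_union hm hm1]
  ext x
  constructor
  · rintro (⟨i, -, h⟩ | ⟨i, -, h⟩) <;> exact ⟨i, h⟩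
  · rintro ⟨i, h⟩
    exact (hm.isShort_or_isLong hm1 i).imp (fun hi ↦ ⟨i, hi, h⟩) (fun hi ↦ ⟨i, hi, h⟩)

omit [P.IsCrystallographic] [P.IsReduced] in
-- Tested on `p_α + s` and `p_α + l`; with `cosetRoots_mono` it turns inclusion into divisibility.
theorem dvd_of_cosetRoots_subset (hm : IsLacingNumber P m) (hm1 : m ≠ 1)
    {p : P.rootSpan ℤ →ₗ[ℤ] ℤ} {s l s' l' : ℕ} (h : cosetRoots p s l ⊆ cosetRoots p s' l') :
    s' ∣ s ∧ l' ∣ l := by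
  have := nonempty_of_isIrreducible (P := P)
  obtain ⟨i, hi⟩ := exists_isShort P
  obtain ⟨j, hj⟩ := exists_isLong P
  have h1 : (P.root i, ((valueAt p i + s : ℤ) : ℝ)) ∈ cosetRoots p s l :=
    mem_cosetRoots.2 ⟨by simp, fun h ↦ (hm.not_isLong_of_isShort hm1 hi h).elim⟩
  have h2 : (P.root j, ((valueAt p j + l : ℤ) : ℝ)) ∈ cosetRoots p s l :=
    mem_cosetRoots.2 ⟨fun h ↦ (hm.not_isLong_of_isShort hm1 h hj).elim, by simp⟩
  have h3 := (mem_cosetRoots.1 (h h1)).1 hi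
  have h4 := (mem_cosetRoots.1 (h h2)).2 hj
  rw [add_sub_cancel_left] at h3 h4
  exact ⟨by exact_mod_cast h3, by exact_mod_cast h4⟩

/-! ### Subsystems of full gradient as pairs `(s, l)`, and maximality -/

namespace ExtensionDatum.IsTwistedAffine

variable {E : ExtensionDatum P ℝ} (hE : E.IsTwistedAffine m)
include hE

theorem exists_intCast_eq {i : ι} {y : ℝ} (hy : y ∈ E.Λ i) : ∃ k : ℤ, y = k := by
  rcases hE.lacing.isShort_or_isLong hE.ne_one i with hi | hi
  · rwa [hE.short_eq i hi] at hy
  · rw [hE.long_eq i hi] at hy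
    obtain ⟨k, rfl⟩ := hy
    exact ⟨m * k, by push_cast; rfl⟩

theorem intCast_mem {i : ι} {k : ℤ} : (k : ℝ) ∈ E.Λ i ↔ (IsLong P i → (m : ℤ) ∣ k) := by
  rcases hE.lacing.isShort_or_isLong hE.ne_one i with hi | hi
  · simp [hE.short_eq i hi, hE.lacing.not_isLong_of_isShort hE.ne_one hi]
  · simp only [hE.long_eq i hi, mem_ofPred_eq, hi, forall_const]
    exact exists_congr fun c ↦ by norm_cast

theorem subset_of_forall_intCast {Ψ Ψ' : Set (V × ℝ)} (hΨ : Ψ ⊆ E.realRoots)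
    (h : ∀ (i : ι) (k : ℤ), (P.root i, (k : ℝ)) ∈ Ψ → (P.root i, (k : ℝ)) ∈ Ψ') : Ψ ⊆ Ψ' := by
  rintro ⟨_, y⟩ hx
  obtain ⟨i, rfl, hy⟩ := mem_realRoots.1 (hΨ hx)
  obtain ⟨k, rfl⟩ := hE.exists_intCast_eq hy
  exact h i k hx

theorem realRoots_eq_cosetRoots {p : P.rootSpan ℤ →ₗ[ℤ] ℤ}
    (hp : ∀ i, (valueAt p i : ℝ) ∈ E.Λ i) : E.realRoots = cosetRoots p 1 m := by
  have key (i : ι) (k : ℤ) :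
      (P.root i, (k : ℝ)) ∈ E.realRoots ↔ (P.root i, (k : ℝ)) ∈ cosetRoots p 1 m := by
    rw [root_mk_mem_realRoots, hE.intCast_mem, mem_cosetRoots]
    have h := hE.intCast_mem.1 (hp i)
    simp only [Nat.cast_one, one_dvd, implies_true, true_and]
    exact forall_congr' fun hi ↦ (dvd_sub_left (h hi)).symm
  refine (hE.subset_of_forall_intCast subset_rfl fun i k ↦ (key i k).1).antisymm ?_
  rintro _ ⟨i, k, rfl, h⟩
  exact (key i k).2 (mem_cosetRoots.2 h)

/-- All shifts are multiples of `s` because `s ∣ l`. A short root moves a long one by a pairing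
divisible by `m`, so by a multiple of `m * s`, hence of `l`. The condition `m ∣ l` keeps the set
inside `Φ`. -/
theorem isRootSubsystem_cosetRoots {p : P.rootSpan ℤ →ₗ[ℤ] ℤ}
    (hp : ∀ i, (valueAt p i : ℝ) ∈ E.Λ i) {s l : ℕ} (hsl : s ∣ l) (hls : l ∣ m * s) (hml : m ∣ l) :
    IsRootSubsystem (affineForm P ℝ) E.realRoots (cosetRoots p s l) where
  nonempty := by
    have := nonempty_of_isIrreducible (P := P)
    exact ⟨_, root_valueAt_mem_cosetRoots p s l (Classical.arbitrary ι)⟩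
  subset := hE.realRoots_eq_cosetRoots hp ▸ cosetRoots_mono p (one_dvd s) hml
  refl_mem := by
    rintro _ ⟨i, a, rfl, ha, ha'⟩ _ ⟨j, b, rfl, hb, hb'⟩
    rw [formReflection_affineForm, ← P.algebraMap_pairingIn ℤ, smul_eq_mul, eq_intCast,
      ← Int.cast_mul, ← Int.cast_sub, mem_cosetRoots, isShort_reflectionPerm,
      isLong_reflectionPerm, valueAt_reflectionPerm,
      show b - P.pairingIn ℤ j i * a - (valueAt p j - P.pairingIn ℤ j i * valueAt p i) =
        (b - valueAt p j) - P.pairingIn ℤ j i * (a - valueAt p i) by ring]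
    have hs : (s : ℤ) ∣ a - valueAt p i :=
      (hE.lacing.isShort_or_isLong hE.ne_one i).elim ha
        fun h ↦ (Int.natCast_dvd_natCast.2 hsl).trans (ha' h)
    refine ⟨fun hj ↦ dvd_sub (hb hj) (hs.mul_left _), fun hj ↦ dvd_sub (hb' hj) ?_⟩
    rcases hE.lacing.isShort_or_isLong hE.ne_one i with hi | hi
    · rw [hE.lacing.pairingIn_eq_mul hi hj, mul_right_comm]
      refine Dvd.dvd.mul_right ?_ _
      exact (Int.natCast_dvd_natCast.2 hls).trans (by push_cast; exact mul_dvd_mul_left _ hs)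
    · exact (ha' hi).mul_left _

variable {Ψ : Set (V × ℝ)} (hΨ : IsRootSubsystem (affineForm P ℝ) E.realRoots Ψ)
include hΨ

theorem exists_valueAt_mem (hgr : E.gradient Ψ = range P.root) :
    ∃ p : P.rootSpan ℤ →ₗ[ℤ] ℤ, ∀ i, (P.root i, (valueAt p i : ℝ)) ∈ Ψ := by
  refine hΨ.isReflectionClosed_intFibre.exists_valueAt_mem fun i ↦ ?_
  obtain ⟨y, hy⟩ := (mem_gradient hΨ.subset).1 (hgr ▸ mem_range_self i)
  obtain ⟨k, rfl⟩ := hE.exists_intCast_eq (root_mk_mem_realRoots.1 (hΨ.subset hy))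
  exact ⟨k, hy⟩

/-- A root subsystem with full gradient is made of cosets of two subgroups of `ℤ`. -/
theorem exists_eq_cosetRoots {p : P.rootSpan ℤ →ₗ[ℤ] ℤ}
    (hp : ∀ i, (P.root i, (valueAt p i : ℝ)) ∈ Ψ) :
    ∃ s l : ℕ, s ∣ l ∧ l ∣ m * s ∧ m ∣ l ∧ Ψ = cosetRoots p s l := by
  have hpΛ (i : ι) : (valueAt p i : ℝ) ∈ E.Λ i := root_mk_mem_realRoots.1 (hΨ.subset (hp i))
  have hF := hΨ.isReflectionClosed_intFibre.preimage_valueAt_add p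
  obtain ⟨s, l, hsl, hls, hs, hl⟩ := hF.exists_dvd
    (fun i ↦ by simpa [intFibre] using hp i) hE.lacing hE.ne_one
  have key (i : ι) (k : ℤ) :
      (P.root i, (k : ℝ)) ∈ Ψ ↔ (P.root i, (k : ℝ)) ∈ cosetRoots p s l := by
    rw [mem_cosetRoots]
    rcases hE.lacing.isShort_or_isLong hE.ne_one i with hi | hi
    · have hi' := hE.lacing.not_isLong_of_isShort hE.ne_one hi
      simpa [intFibre, hi, hi'] using hs i hi (k - valueAt p i)
    · have hi' : ¬ IsShort P i := fun h ↦ hE.lacing.not_isLong_of_isShort hE.ne_one h hi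
      simpa [intFibre, hi, hi'] using hl i hi (k - valueAt p i)
  have hΨ' : Ψ = cosetRoots p s l := by
    refine (hE.subset_of_forall_intCast hΨ.subset fun i k ↦ (key i k).1).antisymm ?_
    rintro _ ⟨i, k, rfl, h⟩
    exact (key i k).2 (mem_cosetRoots.2 h)
  refine ⟨s, l, hsl, hls, ?_, hΨ'⟩
  have := hΨ.subset
  rw [hΨ', hE.realRoots_eq_cosetRoots hpΛ] at this
  exact (dvd_of_cosetRoots_subset hE.lacing hE.ne_one this).2

theorem isMaximalRootSubsystem_lift
    (hmax : IsMaximalRootSubsystem P.RootForm (range P.root) (E.gradient Ψ))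
    (hlong : E.gradient Ψ ≠ longRoots P) (hlift : Ψ = E.lift (E.gradient Ψ)) :
    IsMaximalRootSubsystem (affineForm P ℝ) E.realRoots Ψ := by
  have := nonempty_of_isIrreducible (P := P)
  refine ⟨hΨ, fun h ↦ hmax.ne_top (h ▸ gradient_realRoots), fun Ψ' hΨ' hsub hne ↦ ?_⟩
  by_cases hgr : E.gradient Ψ' = range P.root
  · refine (hne ?_).elim
    obtain ⟨p, hp⟩ := hE.exists_valueAt_mem hΨ' hgr
    obtain ⟨s, l, hsl, hls, hml, rfl⟩ := hE.exists_eq_cosetRoots hΨ' hp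
    -- Otherwise the maximal gradient would lie in the proper subsystem of long roots and equal it.
    obtain ⟨i, hi, hig⟩ : ∃ i, IsShort P i ∧ P.root i ∈ E.gradient Ψ := by
      by_contra! h
      refine hlong (hmax.eq_of_subset _ isRootSubsystem_longRoots (fun v hv ↦ ?_) fun h' ↦ ?_)
      · obtain ⟨i, rfl⟩ := gradient_subset Ψ hv
        exact root_mem_longRoots.2 ((hE.lacing.isShort_or_isLong hE.ne_one i).resolve_left
          fun hi ↦ h i hi hv)
      · obtain ⟨i, hi⟩ := exists_isShort P
        exact hE.lacing.not_isLong_of_isShort hE.ne_one hi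
          (root_mem_longRoots.1 (h' ▸ mem_range_self i))
    have h1 (k : ℤ) : (s : ℤ) ∣ k - valueAt p i := by
      have hk : (P.root i, (k : ℝ)) ∈ Ψ := by
        rw [hlift, root_mk_mem_lift, hE.short_eq i hi]
        exact ⟨hig, k, rfl⟩
      exact (mem_cosetRoots.1 (hsub hk)).1 hi
    have h2 : s = 1 := by
      have := h1 (valueAt p i + 1)
      rw [add_sub_cancel_left] at this
      exact Nat.dvd_one.1 (by exact_mod_cast this)
    subst h2
    rw [mul_one] at hls
    rw [Nat.dvd_antisymm hls hml, hE.realRoots_eq_cosetRoots fun i ↦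
      root_mk_mem_realRoots.1 (hΨ'.subset (hp i))]
  · have h := hmax.eq_of_subset _ (isRootSubsystem_gradient hΨ') (gradient_mono hsub) hgr
    refine hsub.antisymm ((subset_lift_gradient hΨ'.subset).trans ?_)
    rw [← h, ← hlift]

/-- A larger pair `(s', l')` has `s' = 1`, whence `l' = m` and it is `Φ`, or `s' = s`, where `hl`
leaves no room for `l'`. -/
theorem isMaximalRootSubsystem_cosetRoots {p : P.rootSpan ℤ →ₗ[ℤ] ℤ} {s l : ℕ}
    (hs : s.Prime) (hsl : Ψ = cosetRoots p s l)
    (hl : ∀ l', s ∣ l' → l' ∣ l → m ∣ l' → l' = l) :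
    IsMaximalRootSubsystem (affineForm P ℝ) E.realRoots Ψ := by
  subst hsl
  have hp (i : ι) : (valueAt p i : ℝ) ∈ E.Λ i :=
    root_mk_mem_realRoots.1 (hΨ.subset (root_valueAt_mem_cosetRoots p s l i))
  refine ⟨hΨ, fun h ↦ ?_, fun Ψ' hΨ' hsub hne ↦ ?_⟩
  · rw [hE.realRoots_eq_cosetRoots hp] at h
    have := (dvd_of_cosetRoots_subset hE.lacing hE.ne_one h.ge).1
    exact hs.one_lt.ne' (Nat.dvd_one.1 this)
  · obtain ⟨s', l', hsl', hls', hml', rfl⟩ := hE.exists_eq_cosetRoots hΨ' fun i ↦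
      hsub (root_valueAt_mem_cosetRoots p s l i)
    obtain ⟨h1, h2⟩ := dvd_of_cosetRoots_subset hE.lacing hE.ne_one hsub
    rcases (Nat.dvd_prime hs).1 h1 with rfl | rfl
    · refine (hne ?_).elim
      rw [mul_one] at hls'
      rw [Nat.dvd_antisymm hls' hml', hE.realRoots_eq_cosetRoots hp]
    · rw [hl l' hsl' h2 hml']

omit hΨ

theorem isMaximalRootSubsystem_gradient
    (hmax : IsMaximalRootSubsystem (affineForm P ℝ) E.realRoots Ψ)
    (hgr : E.gradient Ψ ≠ range P.root) :
    IsMaximalRootSubsystem P.RootForm (range P.root) (E.gradient Ψ) ∧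
      E.gradient Ψ ≠ longRoots P ∧ Ψ = E.lift (E.gradient Ψ) := by
  have hΨ := hmax.isRootSubsystem
  have hproper {S : Set V} (hS : S ⊆ range P.root) (hne : S ≠ range P.root) :
      E.lift S ≠ E.realRoots := fun h ↦
    hne <| by rw [← gradient_lift (E := E) hS, h, gradient_realRoots]
  have hlift : Ψ = E.lift (E.gradient Ψ) := hmax.eq_of_subset _
    (isRootSubsystem_lift (isRootSubsystem_gradient hΨ)) (subset_lift_gradient hΨ.subset)
    (hproper (gradient_subset Ψ) hgr)
  refine ⟨⟨isRootSubsystem_gradient hΨ, hgr, fun S hS hsub hne ↦ ?_⟩, fun hlong ↦ ?_, hlift⟩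
  · have := hmax.eq_of_subset _ (isRootSubsystem_lift hS)
      ((subset_lift_gradient hΨ.subset).trans (lift_mono hsub)) (hproper hS.subset hne)
    rw [this, gradient_lift hS.subset]
  · have hp (i : ι) : (valueAt (0 : P.rootSpan ℤ →ₗ[ℤ] ℤ) i : ℝ) ∈ E.Λ i :=
      hE.intCast_mem.2 fun _ ↦ by simp [valueAt]
    -- With `p = 0`, the pair `(m, m)` has the same long fibres but full gradient, and it is proper
    -- since `m ≠ 1`.
    have hsub : Ψ ⊆ cosetRoots (0 : P.rootSpan ℤ →ₗ[ℤ] ℤ) m m := by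
      refine hE.subset_of_forall_intCast hΨ.subset fun i k hk ↦ ?_
      rw [hlift, hlong, root_mk_mem_lift, root_mem_longRoots] at hk
      have h := hE.intCast_mem.1 hk.2 hk.1
      rw [mem_cosetRoots]
      simp [valueAt, h]
    have h := hmax.eq_of_subset _
      (hE.isRootSubsystem_cosetRoots hp dvd_rfl (dvd_mul_left m m) dvd_rfl) hsub fun h ↦ by
        rw [hE.realRoots_eq_cosetRoots hp] at h
        exact hE.ne_one (Nat.dvd_one.1 (dvd_of_cosetRoots_subset hE.lacing hE.ne_one h.ge).1)
    refine hgr ((gradient_subset Ψ).antisymm ?_)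
    rintro _ ⟨i, rfl⟩
    exact (mem_gradient hΨ.subset).2 ⟨_, h ▸ root_valueAt_mem_cosetRoots 0 m m i⟩

theorem eq_cosetRoots_of_isMaximalRootSubsystem
    (hmax : IsMaximalRootSubsystem (affineForm P ℝ) E.realRoots Ψ) {p : P.rootSpan ℤ →ₗ[ℤ] ℤ}
    (hp : ∀ i, (P.root i, (valueAt p i : ℝ)) ∈ Ψ) :
    Ψ = cosetRoots p m m ∨ ∃ q : ℕ, q.Prime ∧ Nat.gcd m q = 1 ∧ Ψ = cosetRoots p q (m * q) := by
  have hpΛ (i : ι) : (valueAt p i : ℝ) ∈ E.Λ i :=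
    root_mk_mem_realRoots.1 (hmax.isRootSubsystem.subset (hp i))
  obtain ⟨s, l, hsl, hls, hml, hΨ⟩ := hE.exists_eq_cosetRoots hmax.isRootSubsystem hp
  have hproper {q l' : ℕ} (hq : q ≠ 1) : cosetRoots p q l' ≠ E.realRoots := fun h ↦ by
    rw [hE.realRoots_eq_cosetRoots hpΛ] at h
    exact hq (Nat.dvd_one.1 (dvd_of_cosetRoots_subset hE.lacing hE.ne_one h.ge).1)
  -- If `m ∣ s`, the pair `(m, m)` divides `(s, l)`. Otherwise a prime `q ∣ s` differs from `m`, so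
  -- `m * q ∣ l` and `(q, m * q)` divides `(s, l)`.
  by_cases hms : m ∣ s
  · exact .inl <| hmax.eq_of_subset _
      (hE.isRootSubsystem_cosetRoots hpΛ dvd_rfl (dvd_mul_left m m) dvd_rfl)
      (hΨ ▸ cosetRoots_mono p hms hml) (hproper hE.ne_one)
  · have hs1 : s ≠ 1 := by
      rintro rfl
      rw [mul_one] at hls
      refine hmax.ne_top ?_
      rw [hΨ, Nat.dvd_antisymm hls hml, hE.realRoots_eq_cosetRoots hpΛ]
    obtain ⟨q, hq, hqs⟩ := Nat.exists_prime_and_dvd hs1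
    have hmq : Nat.Coprime m q := (Nat.coprime_primes (hE.lacing.prime hE.ne_one) hq).2 <| by
      rintro rfl
      exact hms hqs
    exact .inr ⟨q, hq, hmq, hmax.eq_of_subset _
      (hE.isRootSubsystem_cosetRoots hpΛ (dvd_mul_left q m) dvd_rfl (dvd_mul_right m q))
      (hΨ ▸ cosetRoots_mono p hqs (hmq.mul_dvd_of_dvd_of_dvd hml (hqs.trans hsl)))
      (hproper hq.ne_one)⟩

end ExtensionDatum.IsTwistedAffine

end Affine

end AffineReflection

open AffineReflection in
theorem proposition7p2 {ι V N : Type*} [Fintype ι] [AddCommGroup V] [Module ℝ V]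
    [AddCommGroup N] [Module ℝ N] (P : RootPairing ι ℝ V N) [P.IsRootSystem]
    [P.IsCrystallographic] [P.IsReduced] [P.IsIrreducible]
    (E : ExtensionDatum P ℝ) (m : ℕ) (hE : E.IsTwistedAffine m)
    (Ψ : Set (V × ℝ)) (hΨ : IsRootSubsystem (affineForm P ℝ) E.realRoots Ψ) :
    IsMaximalRootSubsystem (affineForm P ℝ) E.realRoots Ψ ↔
      (IsMaximalRootSubsystem P.RootForm (Set.range P.root) (E.gradient Ψ) ∧
          E.gradient Ψ ≠ longRoots P ∧ Ψ = E.lift (E.gradient Ψ)) ∨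
        (E.gradient Ψ = Set.range P.root ∧
          ∃ p : P.rootSpan ℤ →ₗ[ℤ] ℤ, (∀ i, (valueAt p i : ℝ) ∈ E.fibre Ψ i) ∧
            (Ψ = {x | ∃ i, ∃ k : ℤ, x = (P.root i, (valueAt p i + m * k : ℝ))} ∨
              ∃ q : ℕ, q.Prime ∧ Nat.gcd m q = 1 ∧
                Ψ = {x | ∃ i, IsShort P i ∧ ∃ k : ℤ,
                      x = (P.root i, (valueAt p i + q * k : ℝ))} ∪
                    {x | ∃ i, IsLong P i ∧ ∃ k : ℤ,
                      x = (P.root i, (valueAt p i + m * q * k : ℝ))})) := by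
  simp only [← Nat.cast_mul, ← cosetRoots_self hE.lacing hE.ne_one,
    ← cosetRoots_eq_union hE.lacing hE.ne_one]
  constructor
  · intro hmax
    by_cases hgr : E.gradient Ψ = Set.range P.root
    · obtain ⟨p, hp⟩ := hE.exists_valueAt_mem hΨ hgr
      exact .inr ⟨hgr, p, fun i ↦ ⟨ExtensionDatum.root_mk_mem_realRoots.1 (hΨ.subset (hp i)), hp i⟩,
        hE.eq_cosetRoots_of_isMaximalRootSubsystem hmax hp⟩
    · exact .inl (hE.isMaximalRootSubsystem_gradient hmax hgr)
  · rintro (⟨hmax, hlong, hlift⟩ | ⟨-, p, -, h | ⟨q, hq, hmq, h⟩⟩)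
    · exact hE.isMaximalRootSubsystem_lift hΨ hmax hlong hlift
    · exact hE.isMaximalRootSubsystem_cosetRoots hΨ (hE.lacing.prime hE.ne_one) h
        fun l' h1 h2 _ ↦ Nat.dvd_antisymm h2 h1
    · exact hE.isMaximalRootSubsystem_cosetRoots hΨ hq h
        fun l' h1 h2 h3 ↦ Nat.dvd_antisymm h2 (Nat.Coprime.mul_dvd_of_dvd_of_dvd hmq h3 h1)
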